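/- For a sequence $(n_l)_{l\ge1}$ of positive integers, let $\bigotimes_l M_{n_l}$ denote the UHF algebra that is the $C^*$-inductive limit of $M_{n_1}(\mathbb C)\otimes\cdots\otimes M_{n_L}(\mathbb C)$, and let $\mathcal Q$ be the universal UHF algebra $M_1\otimes M_2\otimes M_3\otimes\cdots$. Fix a tensor product decomposition of $\mathcal Q$, i.e. a sequence $(n_l)$ together with a $*$-isomorphism $\theta:\bigotimes_l M_{n_l}\to\mathcal Q$. Let $\rho:\prod_{l}\mathbb Z/n_l\mathbb Z\to\prod_{l}U(M_{n_l})$ be the product of the natural representations, in which $1\in\mathbb Z/n_l\mathbb Z$ acts on $\mathbb C^{n_l}$ by the permutation matrix of the $n_l$-cycle, and let $\mathrm{Ad}:\prod_l U(M_{n_l})\to\mathrm{Aut}(\bigotimes_l M_{n_l})\cong\mathrm{Aut}(\mathcal Q)$ (the last identification being via $\theta$) be $\mathrm{Ad}((u_l)_l)=\bigotimes_l\mathrm{Ad}(u_l)$. An automorphism $\beta$ of $\mathcal Q$ is called uniformly outer if for every $a\in\mathcal Q$, every non-zero projection $p\in\mathcal Q$ and every $\varepsilon>0$ there are $k>0$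 and mutually orthogonal projections $p_1,\dots,p_k\in\mathcal Q$ with $p=p_1+\cdots+p_k$ and $\|p_j\,a\,\beta(p_j)\|<\varepsilon$ for $1\le j\le k$. An action $\alpha$ of a group $G$ on $\mathcal Q$ is called uniformly outer if $\alpha_g$ is uniformly outer for every $g\in G$ other than the identity. Let $G$ be an abelian group, let $i:G\hookrightarrow\prod_{l}\mathbb Z/n_l\mathbb Z$ be an injective homomorphism, and let $\alpha=\mathrm{Ad}\circ\rho\circ i:G\to\mathrm{Aut}(\mathcal Q)$. Then $\alpha$ is uniformly outer if and only if $i(G)\cap\bigoplus_{l}\mathbb Z/n_l\mathbb Z=0$. -/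

import Mathlib

noncomputable section

namespace UHF

open Filter Topology

/-- The index set of the standard product basis of `⊗ₗ ℂ^(n l)`. -/
abbrev Config (n : ℕ → ℕ) : Type := ∀ l, ZMod (n l)

/-- The Hilbert space `ℓ²` over all configurations. Each factor `M_{n l}` acts on the `l`-th
coordinate; this represents every finite tensor product `M_{n 0} ⊗ ⋯ ⊗ M_{n (L - 1)}` faithfully,
hence isometrically, so the norm closure of their union is the C⋆-inductive limit. -/
abbrev Hil (n : ℕ → ℕ) : Type := lp (fun _ : Config n => ℂ) 2

/-- The matrix algebra `M_k(ℂ)`, with rows and columns indexed by `ℤ/k`. -/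
abbrev Mat (k : ℕ) : Type := Matrix (ZMod k) (ZMod k) ℂ

section Site

variable {n : ℕ → ℕ}

theorem memlp_weighted (c : Config n → ℂ) (C : ℝ) (hc : ∀ x, ‖c x‖ ≤ C)
    (e : Config n ≃ Config n) (f : Hil n) :
    Memℓp (fun x => c x * f (e x)) 2 := by
  have h2 : (0 : ℝ) < (2 : ENNReal).toReal := by norm_num
  have hf : Summable fun x => ‖f (e x)‖ ^ (2 : ENNReal).toReal :=
    ((lp.memℓp f).summable h2).comp_injective e.injective
  refine memℓp_gen (Summable.of_nonneg_of_le (fun x => by positivity) (fun x => ?_)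
    (hf.mul_left (C ^ (2 : ENNReal).toReal)))
  rw [norm_mul, Real.mul_rpow (norm_nonneg _) (norm_nonneg _)]
  gcongr
  exact hc x

theorem norm_weighted_le (c : Config n → ℂ) (C : ℝ) (hc : ∀ x, ‖c x‖ ≤ C)
    (e : Config n ≃ Config n) (f : Hil n) :
    ‖(⟨fun x => c x * f (e x), memlp_weighted c C hc e f⟩ : Hil n)‖ ≤ C * ‖f‖ := by
  have h2 : (0 : ℝ) < (2 : ENNReal).toReal := by norm_num
  have hC : 0 ≤ C := (norm_nonneg _).trans (hc 0)
  have hf := ((e.hasSum_iff).2 (lp.hasSum_norm h2 f)).mul_left (C ^ (2 : ENNReal).toReal)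
  refine lp.norm_le_of_tsum_le h2 (by positivity) ?_
  rw [Real.mul_rpow hC (norm_nonneg _), ← hf.tsum_eq]
  refine Summable.tsum_le_tsum (fun x => ?_)
    ((memlp_weighted c C hc e f).summable h2) hf.summable
  simp only [Function.comp_apply, norm_mul]
  rw [Real.mul_rpow (norm_nonneg _) (norm_nonneg _)]
  gcongr
  exact hc x

theorem update_eq_add_single (x : Config n) (l : ℕ) (d : ZMod (n l)) :
    Function.update x l (x l + d) = x + Pi.single l d := by
  ext k
  by_cases h : k = l
  · subst h; simp
  · simp [h]

variable [∀ l, NeZero (n l)]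

/-- The sum of the absolute values of the entries. -/
def entryBound {k : ℕ} [NeZero k] (m : Mat k) : ℝ := ∑ i, ∑ j, ‖m i j‖

theorem norm_entry_le {k : ℕ} [NeZero k] (m : Mat k) (i j : ZMod k) :
    ‖m i j‖ ≤ entryBound m :=
  (Finset.single_le_sum (f := fun j => ‖m i j‖) (fun _ _ => norm_nonneg _)
    (Finset.mem_univ j)).trans
    (Finset.single_le_sum (f := fun i => ∑ j, ‖m i j‖)
      (fun _ _ => Finset.sum_nonneg fun _ _ => norm_nonneg _) (Finset.mem_univ i))

/-- One diagonal of the matrix `m`, acting on the `l`-th coordinate. -/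
def diagTerm (l : ℕ) (m : Mat (n l)) (d : ZMod (n l)) (f : Hil n) : Hil n :=
  ⟨fun x => m (x l) (x l + d) * f (Equiv.addRight (Pi.single l d : Config n) x),
    memlp_weighted _ (entryBound m) (fun _ => norm_entry_le _ _ _) _ f⟩

theorem site_fun_eq (l : ℕ) (m : Mat (n l)) (f : Hil n) :
    (fun x : Config n => ∑ j, m (x l) j * f (Function.update x l j)) =
      ((∑ d, diagTerm l m d f : Hil n) : Config n → ℂ) := by
  ext x
  rw [lp.coeFn_sum, Finset.sum_apply, ← Equiv.sum_comp (Equiv.addLeft (x l))]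
  refine Finset.sum_congr rfl fun d _ => ?_
  simp only [diagTerm, Equiv.coe_addLeft, Equiv.coe_addRight, update_eq_add_single]

/-- The matrix `m` acting on the `l`-th coordinate: this is `1 ⊗ ⋯ ⊗ 1 ⊗ m ⊗ 1 ⊗ ⋯`. -/
def siteOp (l : ℕ) (m : Mat (n l)) : Hil n →L[ℂ] Hil n :=
  LinearMap.mkContinuousOfExistsBound
    { toFun := fun f => ⟨fun x => ∑ j, m (x l) j * f (Function.update x l j),
        site_fun_eq l m f ▸ (∑ d, diagTerm l m d f : Hil n).2⟩
      map_add' := fun f g => by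
        ext x
        simp only [lp.coeFn_add, Pi.add_apply, mul_add, Finset.sum_add_distrib]
      map_smul' := fun c f => by
        ext x
        simp only [lp.coeFn_smul, Pi.smul_apply, smul_eq_mul, Finset.mul_sum, mul_left_comm,
          RingHom.id_apply] }
    ⟨Fintype.card (ZMod (n l)) * entryBound m, fun f => by
      have h : (⟨fun x => ∑ j, m (x l) j * f (Function.update x l j),
          site_fun_eq l m f ▸ (∑ d, diagTerm l m d f : Hil n).2⟩ : Hil n) =
          ∑ d, diagTerm l m d f := Subtype.ext (site_fun_eq l m f)
      simp only [LinearMap.coe_mk, AddHom.coe_mk]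
      rw [h]
      refine (norm_sum_le _ _).trans ?_
      refine (Finset.sum_le_sum fun d _ => norm_weighted_le _ (entryBound m)
        (fun _ => norm_entry_le _ _ _) _ f).trans ?_
      simp [mul_assoc]⟩

theorem siteOp_apply (l : ℕ) (m : Mat (n l)) (f : Hil n) (x : Config n) :
    siteOp l m f x = ∑ j, m (x l) j * f (Function.update x l j) := rfl

theorem siteOp_eq_sum (l : ℕ) (m : Mat (n l)) (f : Hil n) :
    siteOp l m f = ∑ d, diagTerm l m d f := Subtype.ext (site_fun_eq l m f)

theorem inner_diagTerm (l : ℕ) (m : Mat (n l)) (d : ZMod (n l)) (f g : Hil n) :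
    inner ℂ (diagTerm l (star m) d f) g = inner ℂ f (diagTerm l m (-d) g) := by
  rw [lp.inner_eq_tsum, lp.inner_eq_tsum,
    ← (Equiv.addRight (Pi.single l d : Config n)).tsum_eq
      (fun x => inner ℂ (f x) (diagTerm l m (-d) g x))]
  refine tsum_congr fun x => ?_
  have h : x + Pi.single l d + Pi.single l (-d) = x := by
    rw [add_assoc, ← Pi.single_add]; simp
  simp [diagTerm, h, Matrix.star_apply]
  ring

/-- The inclusion of the `l`-th tensor factor into the bounded operators. -/
def siteHom (n : ℕ → ℕ) [∀ l, NeZero (n l)] (l : ℕ) :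
    Mat (n l) →⋆ₐ[ℂ] (Hil n →L[ℂ] Hil n) where
  toFun := siteOp l
  map_one' := by
    ext f x
    simp [siteOp_apply, Matrix.one_apply]
  map_mul' a b := by
    ext f x
    change _ = siteOp l a (siteOp l b f) x
    simp only [siteOp_apply, Matrix.mul_apply, Finset.mul_sum,
      Finset.sum_mul, Function.update_self, Function.update_idem]
    rw [Finset.sum_comm]
    simp [mul_assoc]
  map_zero' := by
    ext f x
    simp [siteOp_apply]
  map_add' a b := by
    ext f x
    simp [siteOp_apply, add_mul, Finset.sum_add_distrib]
  commutes' c := by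
    ext f x
    simp [siteOp_apply, Algebra.algebraMap_eq_smul_one, Matrix.one_apply]
  map_star' m := by
    rw [ContinuousLinearMap.star_eq_adjoint, ContinuousLinearMap.eq_adjoint_iff]
    intro f g
    rw [siteOp_eq_sum, siteOp_eq_sum, sum_inner, inner_sum, ← Equiv.sum_comp (Equiv.neg _)]
    refine Finset.sum_congr rfl fun d _ => ?_
    simp [inner_diagTerm]

theorem siteHom_commute {k l : ℕ} (h : k ≠ l) (a : Mat (n k)) (b : Mat (n l)) :
    Commute (siteHom n k a) (siteHom n l b) := by
  ext f x
  change siteOp k a (siteOp l b f) x = siteOp l b (siteOp k a f) x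
  simp only [siteOp_apply, Finset.mul_sum, Function.update_of_ne h, Function.update_of_ne h.symm]
  rw [Finset.sum_comm]
  refine Finset.sum_congr rfl fun j _ => Finset.sum_congr rfl fun i _ => ?_
  rw [Function.update_comm h]
  ring

end Site

/-- The norm closure of the `*`-algebra generated by the commuting unital copies of the matrix
algebras `M_{n l}`. -/
def tensorSubalgebra (n : ℕ → ℕ) [∀ l, NeZero (n l)] :
    StarSubalgebra ℂ (Hil n →L[ℂ] Hil n) :=
  (⨆ l, (siteHom n l).range).topologicalClosure

instance isClosed_tensorSubalgebra (n : ℕ → ℕ) [∀ l, NeZero (n l)] :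
    IsClosed (tensorSubalgebra n : Set (Hil n →L[ℂ] Hil n)) :=
  StarSubalgebra.isClosed_topologicalClosure _

/-- The UHF algebra `⊗ₗ M_{n l}`, as a C⋆-algebra. -/
def TensorAlg (n : ℕ → ℕ) [∀ l, NeZero (n l)] : Type := tensorSubalgebra n

instance instCStarAlgebraTensorAlg (n : ℕ → ℕ) [∀ l, NeZero (n l)] : CStarAlgebra (TensorAlg n) :=
  inferInstanceAs (CStarAlgebra (tensorSubalgebra n))

/-- The inclusion of `⊗ₗ M_{n l}` into the bounded operators. -/
def toOp (n : ℕ → ℕ) [∀ l, NeZero (n l)] : TensorAlg n →⋆ₐ[ℂ] (Hil n →L[ℂ] Hil n) :=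
  (tensorSubalgebra n).subtype

theorem toOp_injective (n : ℕ → ℕ) [∀ l, NeZero (n l)] : Function.Injective (toOp n) :=
  Subtype.val_injective

theorem norm_toOp {n : ℕ → ℕ} [∀ l, NeZero (n l)] (x : TensorAlg n) : ‖toOp n x‖ = ‖x‖ := rfl

/-- The inclusion of the `l`-th tensor factor `M_{n l}` into `⊗ₗ M_{n l}`. -/
def factor (n : ℕ → ℕ) [∀ l, NeZero (n l)] (l : ℕ) : Mat (n l) →⋆ₐ[ℂ] TensorAlg n :=
  (siteHom n l).codRestrict (tensorSubalgebra n) fun m =>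
    StarSubalgebra.le_topologicalClosure _ (le_iSup (fun l => (siteHom n l).range) l ⟨m, rfl⟩)

theorem toOp_factor {n : ℕ → ℕ} [∀ l, NeZero (n l)] (l : ℕ) (m : Mat (n l)) :
    toOp n (factor n l m) = siteHom n l m := rfl

section Ad

variable {n : ℕ → ℕ} [∀ l, NeZero (n l)]

theorem factor_commute {k l : ℕ} (h : k ≠ l) (a : Mat (n k)) (b : Mat (n l)) :
    Commute (factor n k a) (factor n l b) :=
  toOp_injective n (by
    rw [map_mul, map_mul, toOp_factor, toOp_factor, (siteHom_commute h a b).eq])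

/-- The map of unitary groups induced by the inclusion of the `l`-th tensor factor. -/
def factorUnitary (n : ℕ → ℕ) [∀ l, NeZero (n l)] (l : ℕ) :
    unitary (Mat (n l)) →* unitary (TensorAlg n) where
  toFun v := ⟨factor n l v, Unitary.map_mem (factor n l) v.2⟩
  map_one' := Subtype.ext (map_one (factor n l))
  map_mul' _ _ := Subtype.ext (map_mul (factor n l) _ _)

/-- The unitary `u 0 ⊗ ⋯ ⊗ u (L - 1) ⊗ 1 ⊗ 1 ⊗ ⋯`. -/
def partialUnitary (u : ∀ l, unitary (Mat (n l))) : ℕ → unitary (TensorAlg n)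
  | 0 => 1
  | L + 1 => partialUnitary u L * factorUnitary n L (u L)

theorem partialUnitary_commute (u : ∀ l, unitary (Mat (n l))) {L l : ℕ} (h : L ≤ l)
    (b : Mat (n l)) : Commute (partialUnitary u L : TensorAlg n) (factor n l b) := by
  induction L with
  | zero => exact Commute.one_left _
  | succ L ih =>
    exact (ih (by omega)).mul_left
      (factor_commute (by omega) (u L : Mat (n L)) b)

theorem partialUnitary_one (L : ℕ) :
    partialUnitary (1 : ∀ l, unitary (Mat (n l))) L = 1 := by
  induction L with
  | zero => rfl
  | succ L ih => rw [partialUnitary, ih]; simp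

theorem partialUnitary_mul (u v : ∀ l, unitary (Mat (n l))) (L : ℕ) :
    partialUnitary (u * v) L = partialUnitary u L * partialUnitary v L := by
  induction L with
  | zero => simp [partialUnitary]
  | succ L ih =>
    have hc : Commute (factorUnitary n L (u L))
        (partialUnitary v L) :=
      Subtype.ext (partialUnitary_commute v le_rfl (u L : Mat (n L))).symm.eq
    simp only [partialUnitary, ih, Pi.mul_apply, map_mul]
    rw [mul_assoc, mul_assoc, ← mul_assoc (partialUnitary v L), ← hc.eq, mul_assoc]

/-- Conjugation by `u 0 ⊗ ⋯ ⊗ u (L - 1) ⊗ 1 ⊗ 1 ⊗ ⋯`. -/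
def partialAd (u : ∀ l, unitary (Mat (n l))) (L : ℕ) : TensorAlg n ≃⋆ₐ[ℂ] TensorAlg n :=
  Unitary.conjStarAlgAut ℂ (TensorAlg n) (partialUnitary u L)

theorem norm_partialAd (u : ∀ l, unitary (Mat (n l))) (L : ℕ) (x : TensorAlg n) :
    ‖partialAd u L x‖ = ‖x‖ := by
  rw [partialAd, Unitary.conjStarAlgAut_apply, ← Unitary.coe_star,
    CStarRing.norm_mul_coe_unitary, CStarRing.norm_coe_unitary_mul]

/-- The operators commuting with all but finitely many tensor factors. -/
def localOps (n : ℕ → ℕ) [∀ l, NeZero (n l)] : StarSubalgebra ℂ (Hil n →L[ℂ] Hil n) where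
  carrier := {T | ∃ L, ∀ l, L ≤ l → ∀ m, Commute (siteHom n l m) T}
  mul_mem' := by
    rintro a b ⟨L, hL⟩ ⟨M, hM⟩
    exact ⟨max L M, fun l hl m => (hL l (le_of_max_le_left hl) m).mul_right
      (hM l (le_of_max_le_right hl) m)⟩
  add_mem' := by
    rintro a b ⟨L, hL⟩ ⟨M, hM⟩
    exact ⟨max L M, fun l hl m => (hL l (le_of_max_le_left hl) m).add_right
      (hM l (le_of_max_le_right hl) m)⟩
  algebraMap_mem' c := ⟨0, fun _ _ _ => (Algebra.commutes c _).symm⟩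
  star_mem' := by
    rintro a ⟨L, hL⟩
    refine ⟨L, fun l hl m => ?_⟩
    have h := (hL l hl (star m)).star_star
    rwa [← map_star, star_star] at h

theorem iSup_range_le_localOps : ⨆ l, (siteHom n l).range ≤ localOps n := by
  refine iSup_le fun k => ?_
  rintro _ ⟨a, rfl⟩
  exact ⟨k + 1, fun l hl m => siteHom_commute (by omega) m a⟩

theorem partialAd_eq_of_local (u : ∀ l, unitary (Mat (n l))) {x : TensorAlg n} {L : ℕ}
    (hx : ∀ l, L ≤ l → ∀ m, Commute (siteHom n l m) (toOp n x)) {M : ℕ}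
    (hM : L ≤ M) : partialAd u M x = partialAd u L x := by
  induction M, hM using Nat.le_induction with
  | base => rfl
  | succ M hM ih =>
    rw [← ih]
    have hc : Commute (factor n M (u M : Mat (n M))) x :=
      toOp_injective n (by rw [map_mul, map_mul, toOp_factor, (hx M hM _).eq])
    have hv : (partialUnitary u (M + 1) : TensorAlg n) =
        partialUnitary u M * factor n M (u M : Mat (n M)) := rfl
    have hu : (factor n M (u M : Mat (n M))) * star (factor n M (u M : Mat (n M))) = 1 :=
      Unitary.mul_star_self_of_mem (factorUnitary n M (u M)).2
    rw [partialAd, partialAd, Unitary.conjStarAlgAut_apply, Unitary.conjStarAlgAut_apply, hv]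
    generalize factor n M (u M : Mat (n M)) = v at hc hu
    generalize (partialUnitary u M : TensorAlg n) = w
    rw [star_mul, mul_assoc w v x, hc.eq, ← mul_assoc w x v, mul_assoc (w * x) v,
      ← mul_assoc v, hu, one_mul]

theorem cauchySeq_partialAd (u : ∀ l, unitary (Mat (n l))) (x : TensorAlg n) :
    CauchySeq fun L => partialAd u L x := by
  rw [Metric.cauchySeq_iff']
  intro ε hε
  obtain ⟨b, hb, hxb⟩ := Metric.mem_closure_iff.1
    (show toOp n x ∈ closure ((⨆ l, (siteHom n l).range :
      StarSubalgebra ℂ (Hil n →L[ℂ] Hil n)) : Set (Hil n →L[ℂ] Hil n)) from x.2) (ε / 2)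
      (half_pos hε)
  obtain ⟨L, hL⟩ := iSup_range_le_localOps hb
  let b' : TensorAlg n := ⟨b, StarSubalgebra.le_topologicalClosure _ hb⟩
  have hd : ∀ M, dist (partialAd u M x) (partialAd u M b') < ε / 2 := fun M => by
    rw [dist_eq_norm, ← map_sub, norm_partialAd, ← norm_toOp, map_sub, ← dist_eq_norm]
    exact hxb
  refine ⟨L, fun M hM => ?_⟩
  have h1 := hd M
  rw [partialAd_eq_of_local u (x := b') hL hM] at h1
  calc dist (partialAd u M x) (partialAd u L x)
      ≤ dist (partialAd u M x) (partialAd u L b') + dist (partialAd u L x) (partialAd u L b') :=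
        dist_triangle_right _ _ _
    _ < ε / 2 + ε / 2 := add_lt_add h1 (hd L)
    _ = ε := add_halves ε

/-- The infinite product `⊗ₗ Ad (u l)`, as the pointwise norm limit of conjugation by
`u 0 ⊗ ⋯ ⊗ u (L - 1) ⊗ 1 ⊗ 1 ⊗ ⋯`. -/
def adFun (u : ∀ l, unitary (Mat (n l))) (x : TensorAlg n) : TensorAlg n :=
  limUnder atTop fun L => partialAd u L x

theorem tendsto_partialAd (u : ∀ l, unitary (Mat (n l))) (x : TensorAlg n) :
    Tendsto (fun L => partialAd u L x) atTop (𝓝 (adFun u x)) :=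
  (cauchySeq_partialAd u x).tendsto_limUnder

theorem adFun_eq {u : ∀ l, unitary (Mat (n l))} {x y : TensorAlg n}
    (h : Tendsto (fun L => partialAd u L x) atTop (𝓝 y)) : adFun u x = y :=
  tendsto_nhds_unique (tendsto_partialAd u x) h

theorem adFun_one (x : TensorAlg n) : adFun 1 x = x :=
  adFun_eq (by simp [partialAd, partialUnitary_one])

theorem adFun_mul (u v : ∀ l, unitary (Mat (n l))) (x : TensorAlg n) :
    adFun (u * v) x = adFun u (adFun v x) := by
  refine adFun_eq ?_
  refine (tendsto_iff_of_dist ?_).2 (tendsto_partialAd u (adFun v x))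
  have h := tendsto_iff_dist_tendsto_zero.1 (tendsto_partialAd v x)
  refine h.congr fun L => ?_
  have : partialAd (u * v) L x = partialAd u L (partialAd v L x) := by
    simp only [partialAd, partialUnitary_mul, map_mul, StarAlgEquiv.mul_apply]
  rw [this, dist_eq_norm, dist_eq_norm, ← map_sub, norm_partialAd]

/-- The homomorphism `Ad : ∏ₗ U(M_{n l}) → Aut (⊗ₗ M_{n l})`. -/
def Ad (n : ℕ → ℕ) [∀ l, NeZero (n l)] :
    (∀ l, unitary (Mat (n l))) →* (TensorAlg n ≃⋆ₐ[ℂ] TensorAlg n) where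
  toFun u :=
    { toFun := adFun u
      invFun := adFun u⁻¹
      left_inv := fun x => by rw [← adFun_mul, inv_mul_cancel, adFun_one]
      right_inv := fun x => by rw [← adFun_mul, mul_inv_cancel, adFun_one]
      map_mul' := fun x y => adFun_eq (by
        simpa only [map_mul] using (tendsto_partialAd u x).mul (tendsto_partialAd u y))
      map_add' := fun x y => adFun_eq (by
        simpa only [map_add] using (tendsto_partialAd u x).add (tendsto_partialAd u y))
      map_star' := fun x => adFun_eq (by
        simpa only [map_star] using (tendsto_partialAd u x).star)
      map_smul' := fun c x => adFun_eq (by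
        simpa only [map_smul] using (tendsto_partialAd u x).const_smul c) }
  map_one' := StarAlgEquiv.ext fun x => adFun_one x
  map_mul' u v := StarAlgEquiv.ext fun x => adFun_mul u v x

end Ad

/-- The natural representation of `ℤ/k` on `ℂ^k`: the element `g` acts by the permutation matrix
of the translation `j ↦ g + j`, so that `1` acts by the `k`-cycle. -/
def cyclicRep (k : ℕ) [NeZero k] : Multiplicative (ZMod k) →* unitary (Mat k) where
  toFun g := ⟨Matrix.of fun i j => if i = g.toAdd + j then 1 else 0, by
    rw [Unitary.mem_iff]
    constructor
    · ext i j
      simp [Matrix.mul_apply, Matrix.one_apply, Matrix.star_apply, apply_ite, eq_comm]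
    · ext i j
      have h : ∀ a x : ZMod k, a = g.toAdd + x ↔ x = a - g.toAdd := fun a x => by
        rw [eq_sub_iff_add_eq', eq_comm]
      simp [Matrix.mul_apply, Matrix.one_apply, Matrix.star_apply, h, eq_comm]⟩
  map_one' := by ext i j; simp [Matrix.one_apply]
  map_mul' g h := by
    ext i j
    simp [Matrix.mul_apply, add_assoc]

/-- The product of the natural representations, `ρ : ∏ₗ ℤ/(n l) → ∏ₗ U(M_{n l})`. -/
def productRep (n : ℕ → ℕ) [∀ l, NeZero (n l)] :
    Multiplicative (∀ l, ZMod (n l)) →* ∀ l, unitary (Mat (n l)) where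
  toFun g l := cyclicRep (n l) (Multiplicative.ofAdd (g.toAdd l))
  map_one' := by ext1 l; exact map_one (cyclicRep (n l))
  map_mul' g h := by ext1 l; exact map_mul (cyclicRep (n l)) _ _

/-- The universal UHF algebra, realized as `M_1 ⊗ M_2 ⊗ M_3 ⊗ ⋯`: every positive integer divides
`1 · 2 ⋯ L` for large `L`, so its supernatural number is `∏ p ^ ∞`. -/
abbrev Q : Type := TensorAlg fun l => l + 1

/-- The isomorphism `Aut A → Aut B` induced by an isomorphism `θ : A → B`. -/
def autCongr {A B : Type*} [CStarAlgebra A] [CStarAlgebra B] (θ : A ≃⋆ₐ[ℂ] B) :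
    (A ≃⋆ₐ[ℂ] A) →* (B ≃⋆ₐ[ℂ] B) where
  toFun f := θ.symm.trans (f.trans θ)
  map_one' := by ext; simp
  map_mul' f g := by ext; simp

/-- For a tensor product decomposition `θ : ⊗ₗ M_{n l} ≅ Q`, the action
`G → ∏ₗ ℤ/(n l) → ∏ₗ U(M_{n l}) → Aut Q`. -/
def modelAction (n : ℕ → ℕ) [∀ l, NeZero (n l)] (θ : TensorAlg n ≃⋆ₐ[ℂ] Q)
    {G : Type*} [AddCommGroup G] (i : G →+ ∀ l, ZMod (n l)) :
    Multiplicative G →* (Q ≃⋆ₐ[ℂ] Q) :=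
  (autCongr θ).comp ((Ad n).comp ((productRep n).comp (AddMonoidHom.toMultiplicative i)))

/-- Uniform outerness of an automorphism: every non-zero projection `p` is, for any `a` and `ε`, a
sum of mutually orthogonal projections `q j` with `‖q j * a * α (q j)‖ < ε`. -/
def IsUniformlyOuter {A : Type*} [CStarAlgebra A] (α : A ≃⋆ₐ[ℂ] A) : Prop :=
  ∀ a p : A, IsStarProjection p → p ≠ 0 → ∀ ε : ℝ, 0 < ε →
    ∃ k : ℕ, 0 < k ∧ ∃ q : Fin k → A,
      (∀ j, IsStarProjection (q j)) ∧
      (∀ j j', j ≠ j' → q j * q j' = 0) ∧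
      p = ∑ j, q j ∧
      ∀ j, ‖q j * a * α (q j)‖ < ε

/-- An action is uniformly outer if every non-identity element acts by a uniformly outer
automorphism. -/
def IsUniformlyOuterAction {A : Type*} [CStarAlgebra A] {Γ : Type*} [Group Γ]
    (α : Γ →* (A ≃⋆ₐ[ℂ] A)) : Prop :=
  ∀ g : Γ, g ≠ 1 → IsUniformlyOuter (α g)

end UHF

end

/-!
If infinitely many coordinates of `g` are non-zero, any two elements commuting with almost all
tensor factors commute with some factor on which `g` acts non-trivially. The rank one diagonal
projections `e j` of that factor are permuted without fixed points by `α = Ad (ρ g)`, so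
`e j * c * α (e j) = 0` for every `c` commuting with the `e j`. A given projection `p` is of the
form `u q u⋆`, with `u` unitary and `q` a projection commuting with almost all factors. Putting
`p j = u (q e j) u⋆`, the norm of `p j * a * α (p j)` is that of `q e j * c * α (q e j)` with
`c = u⋆ * a * α u`. Hence it suffices to choose the `e j` after `u`, commuting with `q` and with a
good approximation of `c`; no estimate on `u` is needed.

If only finitely many coordinates are non-zero, `α` is conjugation by a unitary `w`. Then
`q * w⋆ * α q = q * w⋆` has norm `‖q‖` for every projection `q`, so `1` admits no decomposition
with `a = w⋆` and `ε = 1`.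
-/

namespace UHF

section Projections

variable {A : Type*} [CStarAlgebra A]

theorem norm_mul_self_sub_self_le {p : A} (hp : IsStarProjection p) (b : A) :
    ‖b * b - b‖ ≤ ‖p - b‖ * (‖p - b‖ + 3) := by
  have hp1 : ‖p‖ ≤ 1 := hp.norm_le
  have hexpand : b * b - b = (p - b) * (p - b) - p * (p - b) - (p - b) * p + (p - b) := by
    simp only [mul_sub, sub_mul, hp.isIdempotentElem.eq]
    abel
  calc ‖b * b - b‖
      ≤ ‖p - b‖ * ‖p - b‖ + ‖p‖ * ‖p - b‖ + ‖p - b‖ * ‖p‖ + ‖p - b‖ := by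
        rw [hexpand]
        refine (norm_add_le _ _).trans (add_le_add_left ?_ _)
        refine (norm_sub_le _ _).trans (add_le_add ?_ (norm_mul_le _ _))
        exact (norm_sub_le _ _).trans (add_le_add (norm_mul_le _ _) (norm_mul_le _ _))
    _ ≤ ‖p - b‖ * ‖p - b‖ + 1 * ‖p - b‖ + ‖p - b‖ * 1 + ‖p - b‖ := by gcongr
    _ = ‖p - b‖ * (‖p - b‖ + 3) := by ring

theorem abs_mul_self_sub_self_le_of_mem_spectrum {b : A} (hb : IsSelfAdjoint b) {x : ℝ}
    (hx : x ∈ spectrum ℝ b) : |x * x - x| ≤ ‖b * b - b‖ := by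
  have h := norm_apply_le_norm_cfc (fun x : ℝ => x * x - x) b hx
  rwa [cfc_sub (fun x : ℝ => x * x) (fun x => x) b, cfc_mul (fun x : ℝ => x) (fun x => x) b,
    cfc_id' ℝ b, Real.norm_eq_abs] at h

/-- The projection is the spectral projection of `b` for the interval `(1/2, ∞)`, which the
hypothesis on `b * b - b` separates from the rest of the spectrum. -/
theorem exists_isStarProjection_norm_sub_lt_half {b : A} (hb : IsSelfAdjoint b)
    (hbb : ‖b * b - b‖ < 1 / 4) :
    ∃ q : A, IsStarProjection q ∧ ‖b - q‖ < 1 / 2 ∧ ∀ x, Commute b x → Commute q x := by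
  have hspec (x : ℝ) (hx : x ∈ spectrum ℝ b) : |x * x - x| < 1 / 4 :=
    (abs_mul_self_sub_self_le_of_mem_spectrum hb hx).trans_lt hbb
  let f : ℝ → ℝ := fun x => if x ≤ 1 / 2 then 0 else 1
  have hf : ContinuousOn f (spectrum ℝ b) := by
    refine ContinuousOn.if ?_ continuousOn_const continuousOn_const
    rintro x ⟨hx, hx_frontier⟩
    obtain rfl : x = 1 / 2 := by
      rwa [show {a : ℝ | a ≤ 1 / 2} = Set.Iic (1 / 2) from rfl, frontier_Iic] at hx_frontier
    have hhalf := hspec _ hx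
    norm_num at hhalf
  refine ⟨cfc f b, ⟨?_, cfc_predicate f b⟩, ?_, fun x hx => hx.cfc_real f⟩
  · rw [IsIdempotentElem, ← cfc_mul f f b]
    exact cfc_congr fun x _ => by simp [f]
  · nth_rewrite 1 [← cfc_id' ℝ b]
    rw [← cfc_sub (fun x : ℝ => x) f b]
    refine norm_cfc_lt one_half_pos fun x hx => ?_
    have h := abs_lt.1 (hspec x hx)
    rw [Real.norm_eq_abs, abs_lt]
    by_cases hx2 : x ≤ 1 / 2
    · simp only [f, if_pos hx2]
      constructor <;> nlinarith
    · simp only [f, if_neg hx2]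
      constructor <;> nlinarith

theorem exists_isStarProjection_norm_sub_lt_one {p b : A} (hp : IsStarProjection p)
    (hb : IsSelfAdjoint b) (hpb : ‖p - b‖ < 1 / 16) :
    ∃ q : A, IsStarProjection q ∧ ‖p - q‖ < 1 ∧ ∀ x, Commute b x → Commute q x := by
  have hbb : ‖b * b - b‖ < 1 / 4 :=
    (norm_mul_self_sub_self_le hp b).trans_lt (by nlinarith [norm_nonneg (p - b)])
  obtain ⟨q, hq, hbq, hcomm⟩ := exists_isStarProjection_norm_sub_lt_half hb hbb
  exact ⟨q, hq, by linarith [norm_sub_le_norm_sub_add_norm_sub p b q], hcomm⟩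

/-- The unitary is the one in the polar decomposition `z = u |z|`. -/
theorem exists_unitary_mul_eq_mul {z p q : A} (hz : IsUnit z) (hp : IsSelfAdjoint p)
    (hq : IsSelfAdjoint q) (h : z * q = p * z) : ∃ u : unitary A, (u : A) * q = p * u := by
  let _ := CStarAlgebra.spectralOrder A
  let _ := CStarAlgebra.spectralOrderedRing A
  have hstar : q * star z = star z * p := by
    simpa only [star_mul, hp.star_eq, hq.star_eq] using congrArg star h
  have hcomm : Commute (star z * z) q := by
    rw [Commute, SemiconjBy, mul_assoc, h, ← mul_assoc, ← hstar, mul_assoc]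
  obtain ⟨r, hr⟩ : IsUnit (CFC.abs z) := by
    rw [← isUnit_mul_self_iff, CFC.abs_mul_abs]
    exact hz.star.mul hz
  have hrq : Commute (↑r⁻¹ : A) q := by
    refine Commute.units_inv_left ?_
    rw [hr]
    exact hcomm.cfcₙ_nnreal _
  have habs : star (CFC.abs z) = CFC.abs z := (CFC.abs_nonneg z).isSelfAdjoint
  obtain ⟨z, rfl⟩ := hz
  refine ⟨⟨z * ↑r⁻¹, (Units.mul_inv_mem_unitary z r).2 (Units.ext ?_)⟩, ?_⟩
  · simp only [Units.val_mul, Units.coe_star, hr, habs, CFC.abs_mul_abs]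
  · rw [mul_assoc, hrq.eq, ← mul_assoc, h, mul_assoc]

theorem isUnit_mul_add_one_sub_mul_one_sub {p q : A} (hp : IsStarProjection p)
    (hq : IsStarProjection q) (hpq : ‖p - q‖ < 1) : IsUnit (p * q + (1 - p) * (1 - q)) := by
  have hpp := hp.isIdempotentElem.eq
  have hqq := hq.isIdempotentElem.eq
  have hpp' (x : A) : p * (p * x) = p * x := by rw [← mul_assoc, hpp]
  have hqq' (x : A) : q * (q * x) = q * x := by rw [← mul_assoc, hqq]
  set z : A := p * q + (1 - p) * (1 - q) with hz
  have hstar : star z = q * p + (1 - q) * (1 - p) := by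
    simp only [hz, star_add, star_mul, star_sub, star_one, hp.isSelfAdjoint.star_eq,
      hq.isSelfAdjoint.star_eq]
  have hzz : star z * z = 1 - (p - q) * (p - q) := by
    rw [hstar, hz]
    simp only [mul_add, add_mul, mul_sub, sub_mul, mul_one, one_mul, mul_assoc, hpp, hqq, hpp']
    abel
  have hzz' : z * star z = 1 - (p - q) * (p - q) := by
    rw [hstar, hz]
    simp only [mul_add, add_mul, mul_sub, sub_mul, mul_one, one_mul, mul_assoc, hpp, hqq, hqq']
    abel
  have hunit : IsUnit (1 - (p - q) * (p - q)) :=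
    isUnit_one_sub_of_norm_lt_one ((norm_mul_le _ _).trans_lt
      (mul_lt_one_of_nonneg_of_lt_one_left (norm_nonneg _) hpq hpq.le))
  have hcomm : Commute (star z) z := hzz.trans hzz'.symm
  exact (hcomm.isUnit_mul_iff.1 (hzz ▸ hunit)).2

theorem exists_conjStarAlgAut_apply_eq_of_norm_sub_lt_one {p q : A} (hp : IsStarProjection p)
    (hq : IsStarProjection q) (hpq : ‖p - q‖ < 1) :
    ∃ u : unitary A, Unitary.conjStarAlgAut ℂ A u q = p := by
  have hintertwine :
      (p * q + (1 - p) * (1 - q)) * q = p * (p * q + (1 - p) * (1 - q)) := by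
    simp only [add_mul, mul_add, mul_assoc, hq.one_sub_mul_self, hq.isIdempotentElem.eq,
      ← mul_assoc p, hp.mul_one_sub_self, hp.isIdempotentElem.eq, mul_zero, zero_mul]
  obtain ⟨u, hu⟩ := exists_unitary_mul_eq_mul (isUnit_mul_add_one_sub_mul_one_sub hp hq hpq)
    hp.isSelfAdjoint hq.isSelfAdjoint hintertwine
  refine ⟨u, ?_⟩
  rw [Unitary.conjStarAlgAut_apply, hu, mul_assoc, Unitary.mul_star_self_of_mem u.2, mul_one]

end Projections

section SmallDecomposition

variable {A : Type*} [CStarAlgebra A] {ι : Type*} [Fintype ι]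

/-- A decomposition of the projection `p` into orthogonal projections `q j` as in the definition of
uniform outerness, for an arbitrary finite index type, which may be empty. -/
structure IsSmallDecomposition (α : A ≃⋆ₐ[ℂ] A) (a p : A) (ε : ℝ) (q : ι → A) : Prop where
  isStarProjection (j : ι) : IsStarProjection (q j)
  ortho ⦃j j' : ι⦄ : j ≠ j' → q j * q j' = 0
  sum_eq : ∑ j, q j = p
  norm_lt (j : ι) : ‖q j * a * α (q j)‖ < ε

theorem isUniformlyOuter_iff_exists_isSmallDecomposition {α : A ≃⋆ₐ[ℂ] A} :
    IsUniformlyOuter α ↔ ∀ a p : A, IsStarProjection p → p ≠ 0 → ∀ ε : ℝ, 0 < ε →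
      ∃ (κ : Type) (_ : Fintype κ) (q : κ → A), IsSmallDecomposition α a p ε q := by
  constructor
  · intro h a p hp hp0 ε hε
    obtain ⟨k, -, q, hq, hortho, hsum, hnorm⟩ := h a p hp hp0 ε hε
    exact ⟨Fin k, inferInstance, q, hq, fun j j' => hortho j j', hsum.symm, hnorm⟩
  · intro h a p hp hp0 ε hε
    obtain ⟨κ, _, q, hq⟩ := h a p hp hp0 ε hε
    have hκ : Nonempty κ := by
      by_contra hempty
      have := not_nonempty_iff.1 hempty
      exact hp0 (by rw [← hq.sum_eq, Fintype.sum_empty])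
    let σ := (Fintype.equivFin κ).symm
    exact ⟨Fintype.card κ, Fintype.card_pos, fun j => q (σ j), fun j => hq.isStarProjection _,
      fun _ _ hj => hq.ortho (σ.injective.ne hj), by rw [σ.sum_comp q, hq.sum_eq],
      fun j => hq.norm_lt _⟩

theorem IsSmallDecomposition.autCongr {B : Type*} [CStarAlgebra B] (θ : A ≃⋆ₐ[ℂ] B)
    {α : A ≃⋆ₐ[ℂ] A} {a p : A} {ε : ℝ} {q : ι → A} (h : IsSmallDecomposition α a p ε q) :
    IsSmallDecomposition (autCongr θ α) (θ a) (θ p) ε fun j => θ (q j) where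
  isStarProjection j := (h.isStarProjection j).map θ
  ortho j j' hj := by rw [← map_mul, h.ortho hj, map_zero]
  sum_eq := by rw [← map_sum, h.sum_eq]
  norm_lt j := by simpa [UHF.autCongr, ← map_mul, StarAlgEquiv.norm_map] using h.norm_lt j

theorem IsUniformlyOuter.autCongr {B : Type*} [CStarAlgebra B] (θ : A ≃⋆ₐ[ℂ] B)
    {α : A ≃⋆ₐ[ℂ] A} (h : IsUniformlyOuter α) : IsUniformlyOuter (autCongr θ α) := by
  rw [isUniformlyOuter_iff_exists_isSmallDecomposition] at h ⊢
  intro a p hp hp0 ε hε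
  obtain ⟨κ, _, q, hq⟩ := h (θ.symm a) (θ.symm p) (hp.map θ.symm) (by simpa using hp0) ε hε
  exact ⟨κ, _, _, by simpa using hq.autCongr θ⟩

theorem isUniformlyOuter_autCongr_iff {B : Type*} [CStarAlgebra B] (θ : A ≃⋆ₐ[ℂ] B)
    {α : A ≃⋆ₐ[ℂ] A} : IsUniformlyOuter (autCongr θ α) ↔ IsUniformlyOuter α := by
  refine ⟨fun h => ?_, fun h => h.autCongr θ⟩
  convert h.autCongr θ.symm
  ext x
  simp [autCongr]

theorem IsSmallDecomposition.conjStarAlgAut {α : A ≃⋆ₐ[ℂ] A} {a p : A} {ε : ℝ} {q : ι → A}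
    (u : unitary A) (h : IsSmallDecomposition α (star (u : A) * a * α u) p ε q) :
    IsSmallDecomposition α a (Unitary.conjStarAlgAut ℂ A u p) ε
      fun j => Unitary.conjStarAlgAut ℂ A u (q j) where
  isStarProjection j := (h.isStarProjection j).map _
  ortho j j' hj := by rw [← map_mul, h.ortho hj, map_zero]
  sum_eq := by rw [← map_sum, h.sum_eq]
  norm_lt j := by
    have hαu : star (α u) ∈ unitary A := Unitary.star_mem (Unitary.map_mem α u.2)
    have hfactor : Unitary.conjStarAlgAut ℂ A u (q j) * a *
          α (Unitary.conjStarAlgAut ℂ A u (q j)) =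
        u * (q j * (star (u : A) * a * α u) * α (q j)) * star (α u) := by
      simp only [Unitary.conjStarAlgAut_apply, map_mul, map_star, mul_assoc]
    rw [hfactor, CStarRing.norm_mul_mem_unitary _ hαu, CStarRing.norm_mem_unitary_mul _ u.2]
    exact h.norm_lt j

end SmallDecomposition

section DisplacedPartition

/-- A finite partition of unity into projections, each orthogonal to its image under `α`. -/
structure IsDisplacedPartition {A : Type*} [Semiring A] [Star A] {ι : Type*} [Fintype ι]
    (α : A → A) (e : ι → A) : Prop extends CompleteOrthogonalIdempotents e where
  isSelfAdjoint (j : ι) : IsSelfAdjoint (e j)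
  mul_apply_eq_zero (j : ι) : e j * α (e j) = 0

theorem IsDisplacedPartition.map {A B F : Type*} [Semiring A] [Star A] [Semiring B] [Star B]
    [FunLike F A B] [RingHomClass F A B] [StarHomClass F A B] {ι : Type*} [Fintype ι]
    {α : A → A} {β : B → B} {e : ι → A} (h : IsDisplacedPartition α e) (f : F)
    (hf : ∀ x, β (f x) = f (α x)) : IsDisplacedPartition β fun j => f (e j) where
  toCompleteOrthogonalIdempotents := h.toCompleteOrthogonalIdempotents.map (f : A →+* B)
  isSelfAdjoint j := (h.isSelfAdjoint j).map f
  mul_apply_eq_zero j := by rw [hf, ← map_mul, h.mul_apply_eq_zero, map_zero]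

variable {A : Type*} [CStarAlgebra A] {α : A ≃⋆ₐ[ℂ] A}

theorem IsDisplacedPartition.isSmallDecomposition {ι : Type*} [Fintype ι] {e : ι → A}
    (he : IsDisplacedPartition α e) {q : A} (hq : IsStarProjection q)
    (hqe : ∀ j, Commute q (e j)) {c c' : A} (hc : ∀ j, Commute c' (e j)) {ε : ℝ}
    (hcc' : ‖c - c'‖ < ε) : IsSmallDecomposition α c q ε fun j => q * e j := by
  have hproj (j : ι) : IsStarProjection (q * e j) :=
    hq.mul ⟨he.idem j, he.isSelfAdjoint j⟩ (hqe j)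
  refine ⟨hproj, fun j j' hj => ?_, by rw [← Finset.mul_sum, he.complete, mul_one], fun j => ?_⟩
  · rw [mul_assoc, ← mul_assoc (e j), ← (hqe j).eq, mul_assoc q (e j), he.ortho hj,
      mul_zero, mul_zero]
  · have hzero : q * e j * c' * α (q * e j) = 0 := by
      calc q * e j * c' * α (q * e j) = q * c' * (e j * α (e j)) * α q := by
            rw [mul_assoc q, ← (hc j).eq, (hqe j).eq, map_mul]
            simp only [mul_assoc]
        _ = 0 := by rw [he.mul_apply_eq_zero, mul_zero, zero_mul]
    calc ‖q * e j * c * α (q * e j)‖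
        = ‖q * e j * (c - c') * α (q * e j)‖ := by rw [mul_sub, sub_mul, hzero, sub_zero]
      _ ≤ ‖q * e j‖ * ‖c - c'‖ * ‖α (q * e j)‖ :=
        (norm_mul_le _ _).trans (by gcongr; exact norm_mul_le _ _)
      _ ≤ 1 * ‖c - c'‖ * 1 := by
        rw [StarAlgEquiv.norm_map]
        gcongr <;> exact (hproj j).norm_le
      _ < ε := by rwa [one_mul, mul_one]

theorem isUniformlyOuter_of_dense {S : Set A} (hS : Dense S)
    (h : ∀ a ∈ S, ∀ b ∈ S, ∃ (ι : Type) (_ : Fintype ι) (e : ι → A),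
      IsDisplacedPartition α e ∧ ∀ j, Commute a (e j) ∧ Commute b (e j)) :
    IsUniformlyOuter α := by
  rw [isUniformlyOuter_iff_exists_isSmallDecomposition]
  intro a p hp _ ε hε
  obtain ⟨b, hbS, hpb⟩ := hS.exists_dist_lt p (show (0 : ℝ) < 1 / 16 by norm_num)
  have hpb' : ‖p - (realPart b : A)‖ < 1 / 16 := by
    rw [← hp.isSelfAdjoint.coe_realPart, ← AddSubgroup.coe_sub, ← map_sub]
    exact (realPart.norm_le _).trans_lt (dist_eq_norm p b ▸ hpb)
  obtain ⟨q, hq, hpq, hcomm⟩ := exists_isStarProjection_norm_sub_lt_one hp (realPart b).2 hpb'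
  obtain ⟨u, rfl⟩ := exists_conjStarAlgAut_apply_eq_of_norm_sub_lt_one hp hq hpq
  obtain ⟨c, hcS, hc⟩ := hS.exists_dist_lt (star (u : A) * a * α u) hε
  obtain ⟨ι, _, e, he, hce⟩ := h c hcS b hbS
  have hqe (j : ι) : Commute q (e j) := by
    refine hcomm _ ?_
    have hstar : Commute (star b) (e j) := by
      simpa only [(he.isSelfAdjoint j).star_eq] using (hce j).2.star_star
    rw [realPart_apply_coe]
    exact ((hce j).2.add_left hstar).smul_left _
  exact ⟨ι, _, _, (he.isSmallDecomposition hq hqe (fun j => (hce j).1)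
    (dist_eq_norm _ c ▸ hc)).conjStarAlgAut u⟩

theorem not_isUniformlyOuter_conjStarAlgAut [Nontrivial A] (w : unitary A) :
    ¬ IsUniformlyOuter (Unitary.conjStarAlgAut ℂ A w) := by
  intro h
  obtain ⟨k, -, q, hq, -, hsum, hnorm⟩ := h (star (w : A)) 1 (.one A) one_ne_zero 1 one_pos
  have hq0 (j : Fin k) : q j = 0 := by
    have hcancel : q j * star (w : A) * Unitary.conjStarAlgAut ℂ A w (q j) =
        q j * star (w : A) := by
      rw [Unitary.conjStarAlgAut_apply, mul_assoc (w : A), mul_assoc (q j),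
        ← mul_assoc (star (w : A)), Unitary.star_mul_self_of_mem w.2, one_mul, ← mul_assoc,
        (hq j).isIdempotentElem.eq]
    have hlt := hnorm j
    rw [hcancel, CStarRing.norm_mul_mem_unitary _ (Unitary.star_mem w.2)] at hlt
    exact (isUnit_one_sub_of_norm_lt_one hlt).mul_left_eq_zero.1 (hq j).mul_one_sub_self
  exact one_ne_zero (hsum.trans (Finset.sum_eq_zero fun j _ => hq0 j))

end DisplacedPartition

section ProductAction

open Filter

variable {n : ℕ → ℕ} [∀ l, NeZero (n l)]

instance : Nontrivial (TensorAlg n) :=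
  have : Nontrivial (Hil n) := by
    classical
    exact ⟨lp.single 2 0 1, 0, fun h => by simpa using congrArg (fun f : Hil n => f 0) h⟩
  (toOp n : TensorAlg n →+* (Hil n →L[ℂ] Hil n)).domain_nontrivial

/-- The elements of the UHF algebra commuting with all but finitely many tensor factors. -/
noncomputable def localElements (n : ℕ → ℕ) [∀ l, NeZero (n l)] : StarSubalgebra ℂ (TensorAlg n) :=
  (localOps n).comap (toOp n)

theorem mem_localElements_iff {x : TensorAlg n} :
    x ∈ localElements n ↔ ∃ L, ∀ l, L ≤ l → ∀ m, Commute (factor n l m) x := by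
  have hcomm (l : ℕ) (m : Mat (n l)) :
      Commute (factor n l m) x ↔ Commute (siteHom n l m) (toOp n x) := by
    rw [← toOp_factor]
    exact ⟨fun h => h.map _, fun h => h.of_map (toOp_injective n)⟩
  simp only [hcomm]
  rfl

theorem dense_localElements : Dense (localElements n : Set (TensorAlg n)) := by
  refine Subtype.dense_iff.2 fun T hT => closure_mono (fun S hS => ?_) hT
  exact ⟨⟨S, StarSubalgebra.le_topologicalClosure _ hS⟩, iSup_range_le_localOps hS, rfl⟩

theorem Ad_eq_partialAd_of_commute_factor (u : ∀ l, unitary (Mat (n l))) {x : TensorAlg n} {L : ℕ}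
    (hx : ∀ l, L ≤ l → ∀ m, Commute (factor n l m) x) : Ad n u x = partialAd u L x := by
  refine adFun_eq (tendsto_const_nhds.congr' ?_)
  filter_upwards [eventually_ge_atTop L] with M hM
  exact (partialAd_eq_of_local u (fun l hl m => (hx l hl m).map (toOp n)) hM).symm

theorem Ad_factor (u : ∀ l, unitary (Mat (n l))) (l : ℕ) (m : Mat (n l)) :
    Ad n u (factor n l m) = factor n l (Unitary.conjStarAlgAut ℂ _ (u l) m) := by
  have hconj : Unitary.conjStarAlgAut ℂ _ (factorUnitary n l (u l)) (factor n l m) =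
      factor n l (Unitary.conjStarAlgAut ℂ _ (u l) m) := by
    simp only [Unitary.conjStarAlgAut_apply, map_mul, map_star]
    rfl
  rw [Ad_eq_partialAd_of_commute_factor u (L := l + 1)
    fun k hk m' => factor_commute (by omega) m' m, partialAd, partialUnitary,
    Unitary.conjStarAlgAut_mul_apply, hconj, Unitary.conjStarAlgAut_apply,
    (partialUnitary_commute u le_rfl _).eq, mul_assoc,
    Unitary.mul_star_self_of_mem (partialUnitary u l).2, mul_one]

theorem partialUnitary_eq_of_le (u : ∀ l, unitary (Mat (n l))) {L : ℕ}
    (hu : ∀ l, L ≤ l → u l = 1) {M : ℕ} (hM : L ≤ M) : partialUnitary u M = partialUnitary u L := by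
  induction M, hM using Nat.le_induction with
  | base => rfl
  | succ M hM ih => rw [partialUnitary, hu M hM, map_one, mul_one, ih]

theorem Ad_eq_partialAd_of_eq_one (u : ∀ l, unitary (Mat (n l))) {L : ℕ}
    (hu : ∀ l, L ≤ l → u l = 1) : Ad n u = partialAd u L := by
  refine StarAlgEquiv.ext fun x => adFun_eq (tendsto_const_nhds.congr' ?_)
  filter_upwards [eventually_ge_atTop L] with M hM
  rw [partialAd, partialAd, partialUnitary_eq_of_le u hu hM]

theorem conjStarAlgAut_cyclicRep_diagonal {k : ℕ} [NeZero k] (g : Multiplicative (ZMod k))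
    (d : ZMod k → ℂ) :
    Unitary.conjStarAlgAut ℂ (Mat k) (cyclicRep k g) (Matrix.diagonal d) =
      Matrix.diagonal fun j => d (j - g.toAdd) := by
  have hmul : (cyclicRep k g : Mat k) * Matrix.diagonal d =
      Matrix.diagonal (fun j => d (j - g.toAdd)) * (cyclicRep k g : Mat k) := by
    ext i j
    by_cases hij : i = g.toAdd + j <;>
      simp [cyclicRep, Matrix.mul_diagonal, Matrix.diagonal_mul, hij]
  rw [Unitary.conjStarAlgAut_apply, hmul, mul_assoc,
    Unitary.mul_star_self_of_mem (cyclicRep k g).2, mul_one]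

theorem isDisplacedPartition_diagonal_single {k : ℕ} [NeZero k] {g : Multiplicative (ZMod k)}
    (hg : g ≠ 1) :
    IsDisplacedPartition (Unitary.conjStarAlgAut ℂ (Mat k) (cyclicRep k g))
      fun j => Matrix.diagonal (Pi.single j 1) where
  toCompleteOrthogonalIdempotents :=
    (CompleteOrthogonalIdempotents.single fun _ : ZMod k => ℂ).map
      (Matrix.diagonalRingHom (ZMod k) ℂ)
  isSelfAdjoint j := Matrix.isHermitian_diagonal_of_self_adjoint _ <| by
    rw [IsSelfAdjoint, Pi.star_single, star_one]
  mul_apply_eq_zero j := by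
    rw [conjStarAlgAut_cyclicRep_diagonal, Matrix.diagonal_mul_diagonal, ← Matrix.diagonal_zero]
    refine congrArg _ (funext fun i => ?_)
    by_cases hij : i = j
    · subst hij
      have hne : i - g.toAdd ≠ i := sub_eq_self.not.2 (toAdd_eq_zero.not.2 hg)
      rw [Pi.single_eq_of_ne hne, mul_zero]
    · rw [Pi.single_eq_of_ne hij, zero_mul]

theorem isUniformlyOuter_Ad_productRep {g : ∀ l, ZMod (n l)} (hg : {l | g l ≠ 0}.Infinite) :
    IsUniformlyOuter (Ad n (productRep n (Multiplicative.ofAdd g))) := by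
  refine isUniformlyOuter_of_dense dense_localElements fun a ha b hb => ?_
  obtain ⟨L, hL⟩ := mem_localElements_iff.1 ha
  obtain ⟨M, hM⟩ := mem_localElements_iff.1 hb
  obtain ⟨l, hgl, hl⟩ := hg.exists_gt (max L M)
  have hdisplaced := isDisplacedPartition_diagonal_single (ofAdd_eq_one.not.2 hgl)
  exact ⟨ZMod (n l), inferInstance, _, hdisplaced.map (factor n l) fun m => Ad_factor _ l m,
    fun j => ⟨(hL l (by omega) _).symm, (hM l (by omega) _).symm⟩⟩

theorem not_isUniformlyOuter_Ad_productRep {g : ∀ l, ZMod (n l)} (hg : {l | g l ≠ 0}.Finite) :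
    ¬ IsUniformlyOuter (Ad n (productRep n (Multiplicative.ofAdd g))) := by
  obtain ⟨L, hL⟩ := hg.bddAbove
  rw [Ad_eq_partialAd_of_eq_one (L := L + 1)]
  · exact not_isUniformlyOuter_conjStarAlgAut _
  · intro l hl
    have hgl : g l = 0 := by
      by_contra h
      exact absurd (hL h) (by omega)
    change cyclicRep (n l) (Multiplicative.ofAdd (g l)) = 1
    rw [hgl, ofAdd_zero, map_one]

end ProductAction

theorem mem_range_coeFnAddMonoidHom_iff {ι : Type*} {M : ι → Type*} [∀ i, AddCommMonoid (M i)]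
    (g : ∀ i, M i) :
    g ∈ Set.range (DirectSum.coeFnAddMonoidHom M) ↔ {i | g i ≠ 0}.Finite := by
  classical
  constructor
  · rintro ⟨x, rfl⟩
    exact DFinsupp.finite_support x
  · intro hg
    refine ⟨DFinsupp.mk hg.toFinset fun i => g i, funext fun i => ?_⟩
    rw [DirectSum.coeFnAddMonoidHom_apply]
    refine DFinsupp.mk_apply.trans ?_
    simp +contextual [eq_comm]

theorem isUniformlyOuter_Ad_productRep_iff {n : ℕ → ℕ} [∀ l, NeZero (n l)]
    (g : ∀ l, ZMod (n l)) :
    IsUniformlyOuter (Ad n (productRep n (Multiplicative.ofAdd g))) ↔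
      g ∉ (DirectSum.coeFnAddMonoidHom fun l => ZMod (n l)).range := by
  rw [← SetLike.mem_coe, AddMonoidHom.coe_range, mem_range_coeFnAddMonoidHom_iff]
  exact ⟨fun h hfin => not_isUniformlyOuter_Ad_productRep hfin h, isUniformlyOuter_Ad_productRep⟩

theorem forall_ne_zero_notMem_iff_injective_and_range_inf_eq_bot {G H : Type*} [AddGroup G]
    [AddGroup H] (f : G →+ H) (D : AddSubgroup H) :
    (∀ g ≠ 0, f g ∉ D) ↔ Function.Injective f ∧ f.range ⊓ D = ⊥ := by
  rw [injective_iff_map_eq_zero, AddSubgroup.eq_bot_iff_forall]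
  constructor
  · intro h
    refine ⟨fun g hg => ?_, ?_⟩
    · by_contra hg0
      exact h g hg0 (hg ▸ D.zero_mem)
    · rintro _ ⟨⟨g, rfl⟩, hgD⟩
      by_contra hg0
      exact h g (fun hg => hg0 (by rw [hg, map_zero])) hgD
  · rintro ⟨hinj, hbot⟩ g hg hgD
    exact hg (hinj g (hbot _ ⟨⟨g, rfl⟩, hgD⟩))

end UHF

theorem mainTheorem6_general (n : ℕ → ℕ) [∀ l, NeZero (n l)] {B : Type*} [CStarAlgebra B]
    (θ : UHF.TensorAlg n ≃⋆ₐ[ℂ] B) {G : Type*} [AddGroup G] (i : G →+ ∀ l, ZMod (n l)) :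
    UHF.IsUniformlyOuterAction ((UHF.autCongr θ).comp
        ((UHF.Ad n).comp ((UHF.productRep n).comp (AddMonoidHom.toMultiplicative i)))) ↔
      Function.Injective i ∧
        i.range ⊓ (DirectSum.coeFnAddMonoidHom fun l => ZMod (n l)).range = ⊥ := by
  rw [← UHF.forall_ne_zero_notMem_iff_injective_and_range_inf_eq_bot]
  exact forall_congr' fun g => imp_congr_right fun _ =>
    (UHF.isUniformlyOuter_autCongr_iff θ).trans (UHF.isUniformlyOuter_Ad_productRep_iff (i g.toAdd))

theorem mainTheorem6 (n : ℕ → ℕ) [∀ l, NeZero (n l)] (θ : UHF.TensorAlg n ≃⋆ₐ[ℂ] UHF.Q)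
    {G : Type*} [AddCommGroup G] (i : G →+ ∀ l, ZMod (n l)) (hi : Function.Injective i) :
    UHF.IsUniformlyOuterAction (UHF.modelAction n θ i) ↔
      i.range ⊓ (DirectSum.coeFnAddMonoidHom fun l => ZMod (n l)).range = ⊥ :=
  (mainTheorem6_general n θ i).trans (and_iff_right hi)
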